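/- Let $A, B, C$ be independent random vectors in $\mathbb{R}^3$, each with the standard Gaussian law $N(0, I)$, and consider the pinned tetrahedron $ABCD$ with fourth vertex $D = (0,0,0)$. Put $$f(z_1,z_2) = \frac{1}{2\pi}\,\frac{\exp\left(z_1+z_2-\sqrt3\sqrt{z_1^2+z_2^2}\right)}{\sqrt{z_1^2+z_2^2}}, \qquad g(z_1,z_2) = \frac{1}{2\sqrt3\,\pi}\exp\left(z_1+z_2-\sqrt3\sqrt{z_1^2+z_2^2}\right),$$ and, for real $w_1, w_2$, with the principal square root (the radicand has positive real part), $$F(w_1,w_2) = \frac{1}{\sqrt{(w_1-i)^2+(w_2-i)^2+3}}.$$ Then: (1) $g$ is integrable on $(0,\infty)^2$, and $$P\big((B-A)\cdot(-A) > 0 \text{ and } (C-A)\cdot(-A) > 0\big) = \int_0^\infty\!\!\int_0^\infty g(z_1,z_2)\,dz_1\,dz_2 = 0.8343764256\dots,$$ that is, the value lies strictly between $0.8343764256$ and $0.8343764257$. (2) For each $k \in \{1,2,3\}$, writing $a, b, c$ for the $k$-th coordinates of $A, B, C$ (independent standard normal variables), the pair $\big((b-a)(-a),\,(c-a)(-a)\big)$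 has joint density $f$. (3) For all real $w_1,w_2$, the functions $e^{i(w_1z_1+w_2z_2)}f$ and $e^{i(w_1z_1+w_2z_2)}g$ are integrable on $\mathbb{R}^2$, and $$\int_{\mathbb{R}^2} e^{i(w_1z_1+w_2z_2)}f(z_1,z_2)\,dz_1\,dz_2 = F(w_1,w_2), \qquad \int_{\mathbb{R}^2} e^{i(w_1z_1+w_2z_2)}g(z_1,z_2)\,dz_1\,dz_2 = F(w_1,w_2)^3.$$ -/

import Mathlib

open MeasureTheory ProbabilityTheory

/-- The joint density `f` of the pair of products `((b - a)(-a), (c - a)(-a))`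
for independent standard normal scalars `a`, `b`, `c`. -/
noncomputable def productDensity (z : ℝ × ℝ) : ℝ :=
  1 / (2 * Real.pi) *
    (Real.exp (z.1 + z.2 - √3 * √(z.1 ^ 2 + z.2 ^ 2)) / √(z.1 ^ 2 + z.2 ^ 2))

/-- The function of `(z₁, z₂)` whose integral over the positive quadrant is the
probability for the pinned tetrahedron. -/
noncomputable def pinnedDensity (z : ℝ × ℝ) : ℝ :=
  1 / (2 * √3 * Real.pi) * Real.exp (z.1 + z.2 - √3 * √(z.1 ^ 2 + z.2 ^ 2))

/-- `F(w₁, w₂) = 1 / √((w₁ - i)² + (w₂ - i)² + 3)`, with the principal square root. For real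
`w₁, w₂` the radicand has real part `w₁² + w₂² + 1 > 0`. -/
noncomputable def productCharFun (w₁ w₂ : ℝ) : ℂ :=
  1 / (((w₁ : ℂ) - Complex.I) ^ 2 + ((w₂ : ℂ) - Complex.I) ^ 2 + 3) ^ (1 / 2 : ℂ)

/-- The Fourier kernel `exp (i (w₁ z₁ + w₂ z₂))`. -/
noncomputable def fourierKernel (w₁ w₂ : ℝ) (z : ℝ × ℝ) : ℂ :=
  Complex.exp (Complex.I * ((w₁ * z.1 + w₂ * z.2 : ℝ) : ℂ))

/-!
Conditionally on the vector `A`, of length `r`, the two products `(B - A) · (-A)` and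
`(C - A) · (-A)` are independent normal variables with mean and variance `r ^ 2`
(`integral_fourierKernel_inner`). Their joint law is therefore a mixture of such normal laws over
the law of `r`, whatever the dimension. In dimension one `r` is half-normal, in dimension three it
has the Maxwell density `√(2 / π) r ^ 2 exp (-r ^ 2 / 2)`.

The mixtures are evaluated in two ways.

* Pointwise, the mixing integral is a Cauchy–Schlömilch integral of
  `exp (-(a ^ 2 r ^ 2 + b ^ 2 / r ^ 2))`, with or without a factor `r ^ (-2)`; this gives
  `productDensity` in dimension one and `pinnedDensity` in dimension three
  (`integral_halfNormal_mul_conditionalDensity`, `integral_maxwell_mul_conditionalDensity`).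
* On the Fourier side, exchanging the integrals leaves the complex Gaussian integrals of
  `exp (-q r ^ 2 / 2)` and `r ^ 2 exp (-q r ^ 2 / 2)`, where `q` is the radicand of
  `productCharFun`; they are `F` and `F ^ 3` up to the normalization.

The characteristic function of the pair of inner products in `ℝ ^ 3` factors over the coordinates
of `A`, so it is `F ^ 3` as well, and that of the pair of products in one coordinate is `F`. Since a
finite measure is determined by its characteristic function, these pairs have the densities
`pinnedDensity` and `productDensity` (`hasLaw_inner_products`, `hasLaw_coordinate_products`).

For the probability, polar coordinates reduce the integral of `pinnedDensity` over the quadrant to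
that of `(√3 - √2 cos t) ^ (-2)` over `[-π / 4, π / 4]`, which has an elementary antiderivative. The
value is `(√3 + 1) / (2 √3 π) + (2 / π) arctan ((√3 + √2) (√2 - 1))`, and partial sums of the
arctangent series bound it to ten decimals.
-/

/-! ### The Cauchy–Schlömilch integral -/

section CauchySchlomilch

variable {a b : ℝ}

lemma hasDerivAt_mul_sub_div (r : ℝ) (hr : r ≠ 0) :
    HasDerivAt (fun r : ℝ => a * r - b / r) (a + b / r ^ 2) r := by
  have h1 := ((hasDerivAt_id r).const_mul a).sub ((hasDerivAt_inv hr).const_mul b)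
  refine (h1.congr_deriv ?_).congr_of_eventuallyEq (.of_forall fun x => ?_)
  · simp [div_eq_mul_inv]
  · simp [div_eq_mul_inv]

lemma injOn_mul_sub_div (ha : 0 < a) (hb : 0 < b) :
    Set.InjOn (fun r : ℝ => a * r - b / r) (Set.Ioi 0) := by
  have : StrictMonoOn (fun r : ℝ => a * r - b / r) (Set.Ioi 0) := by
    intro x hx y hy hxy
    have hx' : 0 < x := hx
    have : b / y < b / x := div_lt_div_of_pos_left hb hx' hxy
    have := mul_lt_mul_of_pos_left hxy ha
    simp only
    linarith
  exact this.injOn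

lemma image_mul_sub_div (ha : 0 < a) (hb : 0 < b) :
    (fun r : ℝ => a * r - b / r) '' Set.Ioi 0 = Set.univ := by
  refine Set.eq_univ_of_forall fun y => ?_
  -- the positive root of `a r ^ 2 - y r - b`
  have hlt : |y| < √(y ^ 2 + 4 * a * b) := by
    rw [← Real.sqrt_sq_eq_abs]
    exact Real.sqrt_lt_sqrt (sq_nonneg y) (by nlinarith [mul_pos ha hb])
  have hsq : √(y ^ 2 + 4 * a * b) ^ 2 = y ^ 2 + 4 * a * b :=
    Real.sq_sqrt (by nlinarith [mul_pos ha hb, sq_nonneg y])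
  set s := √(y ^ 2 + 4 * a * b)
  have hpos : 0 < y + s := by linarith [neg_abs_le y]
  refine ⟨(y + s) / (2 * a), Set.mem_Ioi.2 (by positivity), ?_⟩
  have := hpos.ne'
  simp only
  field_simp
  linear_combination hsq

/-- The substitution `y = a r - b / r` in the Gaussian integral. -/
lemma integrableOn_and_integral_deriv_mul_exp (ha : 0 < a) (hb : 0 < b) :
    IntegrableOn (fun r : ℝ => (a + b / r ^ 2) * Real.exp (-(a * r - b / r) ^ 2)) (Set.Ioi 0) ∧
      ∫ r in Set.Ioi (0 : ℝ), (a + b / r ^ 2) * Real.exp (-(a * r - b / r) ^ 2) = √Real.pi := by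
  have hd : ∀ r ∈ Set.Ioi (0 : ℝ), HasDerivWithinAt (fun r : ℝ => a * r - b / r) (a + b / r ^ 2)
      (Set.Ioi 0) r := fun r hr => (hasDerivAt_mul_sub_div r (ne_of_gt hr)).hasDerivWithinAt
  have hcongr : ∀ r ∈ Set.Ioi (0 : ℝ), |a + b / r ^ 2| • Real.exp (-1 * (a * r - b / r) ^ 2) =
      (a + b / r ^ 2) * Real.exp (-(a * r - b / r) ^ 2) := fun r hr => by
    have : 0 < r := hr
    rw [abs_of_pos (by positivity), smul_eq_mul, neg_one_mul]
  constructor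
  · refine IntegrableOn.congr_fun ?_ hcongr measurableSet_Ioi
    refine (integrableOn_image_iff_integrableOn_abs_deriv_smul measurableSet_Ioi hd
      (injOn_mul_sub_div ha hb) (fun x => Real.exp (-1 * x ^ 2))).1 ?_
    rw [image_mul_sub_div ha hb]
    exact (integrable_exp_neg_mul_sq one_pos).integrableOn
  · rw [← setIntegral_congr_fun measurableSet_Ioi hcongr,
      ← integral_image_eq_integral_abs_deriv_smul measurableSet_Ioi hd
      (injOn_mul_sub_div ha hb) (fun x => Real.exp (-1 * x ^ 2)), image_mul_sub_div ha hb,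
      setIntegral_univ, integral_gaussian]
    simp

/-- The reflection `r ↦ b / (a r)` of the half-line changes the sign of `a r - b / r`. -/
lemma integral_const_mul_exp_eq_integral_div_mul_exp (ha : 0 < a) (hb : 0 < b) :
    ∫ r in Set.Ioi (0 : ℝ), a * Real.exp (-(a * r - b / r) ^ 2) =
      ∫ r in Set.Ioi (0 : ℝ), b / r ^ 2 * Real.exp (-(a * r - b / r) ^ 2) := by
  have hd : ∀ r ∈ Set.Ioi (0 : ℝ), HasDerivWithinAt (fun r : ℝ => b / (a * r))
      (-(b / (a * r ^ 2))) (Set.Ioi 0) r := fun r hr => by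
    have hr' : (0 : ℝ) < r := hr
    have h1 := (hasDerivAt_inv hr'.ne').const_mul (b / a)
    refine HasDerivAt.hasDerivWithinAt ?_
    refine (h1.congr_deriv ?_).congr_of_eventuallyEq (.of_forall fun x => ?_)
    · field_simp
    · simp only [div_eq_mul_inv, mul_inv]
      ring
  have hinj : Set.InjOn (fun r : ℝ => b / (a * r)) (Set.Ioi 0) := by
    intro x hx y hy h
    have hx' : 0 < x := hx
    have hy' : 0 < y := hy
    simp only at h
    field_simp at h
    exact h.symm
  have him : (fun r : ℝ => b / (a * r)) '' Set.Ioi 0 = Set.Ioi 0 := by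
    ext y
    constructor
    · rintro ⟨x, hx, rfl⟩
      have hx' : 0 < x := hx
      exact Set.mem_Ioi.2 (by positivity)
    · intro hy
      have hy' : 0 < y := hy
      refine ⟨b / (a * y), Set.mem_Ioi.2 (by positivity), ?_⟩
      simp only
      field_simp
  conv_lhs => rw [← him]
  rw [integral_image_eq_integral_abs_deriv_smul measurableSet_Ioi hd hinj]
  refine setIntegral_congr_fun measurableSet_Ioi fun r hr => ?_
  have hr' : (0 : ℝ) < r := hr
  have h1 : a * (b / (a * r)) - b / (b / (a * r)) = -(a * r - b / r) := by
    field_simp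
    ring
  simp only [smul_eq_mul]
  rw [h1, abs_neg, abs_of_pos (by positivity), neg_sq]
  field_simp

lemma exp_neg_add_div (r : ℝ) (hr : 0 < r) :
    Real.exp (-(a ^ 2 * r ^ 2 + b ^ 2 / r ^ 2)) =
      Real.exp (-(2 * a * b)) * Real.exp (-(a * r - b / r) ^ 2) := by
  rw [← Real.exp_add]
  congr 1
  field_simp
  ring

lemma integral_deriv_summands_mul_exp (ha : 0 < a) (hb : 0 < b) :
    ∫ r in Set.Ioi (0 : ℝ), a * Real.exp (-(a * r - b / r) ^ 2) = √Real.pi / 2 ∧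
      ∫ r in Set.Ioi (0 : ℝ), b / r ^ 2 * Real.exp (-(a * r - b / r) ^ 2) = √Real.pi / 2 := by
  obtain ⟨hint, hval⟩ := integrableOn_and_integral_deriv_mul_exp ha hb
  have hle : ∀ r ∈ Set.Ioi (0 : ℝ), 0 ≤ b / r ^ 2 * Real.exp (-(a * r - b / r) ^ 2) :=
    fun r _ => by positivity
  have h1 : IntegrableOn (fun r : ℝ => a * Real.exp (-(a * r - b / r) ^ 2)) (Set.Ioi 0) := by
    refine Integrable.mono' hint (by fun_prop) ?_
    filter_upwards [ae_restrict_mem measurableSet_Ioi] with r hr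
    rw [Real.norm_of_nonneg (by positivity), add_mul]
    linarith [hle r hr]
  have h2 : IntegrableOn (fun r : ℝ => b / r ^ 2 * Real.exp (-(a * r - b / r) ^ 2))
      (Set.Ioi 0) := by
    refine (hint.sub h1).congr (.of_forall fun r => ?_)
    simp only [Pi.sub_apply]
    ring
  simp_rw [add_mul] at hval
  rw [integral_add h1 h2] at hval
  have := integral_const_mul_exp_eq_integral_div_mul_exp ha hb
  constructor <;> linarith

/-- The Cauchy–Schlömilch integral: `a r - b / r` maps the half-line bijectively onto the line, and
the two summands `a` and `b / r ^ 2` of its derivative contribute equally. -/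
lemma integral_exp_neg_add_div (ha : 0 < a) (hb : 0 < b) :
    ∫ r in Set.Ioi (0 : ℝ), Real.exp (-(a ^ 2 * r ^ 2 + b ^ 2 / r ^ 2)) =
      √Real.pi / (2 * a) * Real.exp (-(2 * a * b)) := by
  rw [setIntegral_congr_fun measurableSet_Ioi fun r hr => exp_neg_add_div r hr,
    integral_const_mul]
  have h := (integral_deriv_summands_mul_exp ha hb).1
  rw [integral_const_mul] at h
  rw [eq_div_of_mul_eq ha.ne' ((mul_comm _ _).trans h)]
  field_simp

lemma integral_inv_sq_mul_exp_neg_add_div (ha : 0 < a) (hb : 0 < b) :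
    ∫ r in Set.Ioi (0 : ℝ), (r ^ 2)⁻¹ * Real.exp (-(a ^ 2 * r ^ 2 + b ^ 2 / r ^ 2)) =
      √Real.pi / (2 * b) * Real.exp (-(2 * a * b)) := by
  have h := (integral_deriv_summands_mul_exp ha hb).2
  simp_rw [div_eq_mul_inv b, mul_assoc] at h
  rw [integral_const_mul] at h
  rw [setIntegral_congr_fun (g := fun r => Real.exp (-(2 * a * b)) *
    ((r ^ 2)⁻¹ * Real.exp (-(a * r - b / r) ^ 2))) measurableSet_Ioi fun r hr => ?_,
    integral_const_mul]
  · simp_rw [div_eq_mul_inv b]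
    rw [eq_div_of_mul_eq hb.ne' ((mul_comm _ _).trans h)]
    field_simp
  · simp only
    rw [exp_neg_add_div r hr]
    ring

end CauchySchlomilch

/-! ### Complex Gaussian integrals -/

section ComplexGaussian

/-- The radicand `(w₁ - i)² + (w₂ - i)² + 3` of `productCharFun`. -/
noncomputable def charRadicand (w₁ w₂ : ℝ) : ℂ :=
  ((w₁ : ℂ) - Complex.I) ^ 2 + ((w₂ : ℂ) - Complex.I) ^ 2 + 3

/-- The number `s` such that `exp (s r ^ 2)` is the characteristic function at `(w₁, w₂)` of two
independent normal variables with mean and variance `r ^ 2`. -/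
noncomputable def charExponent (w₁ w₂ : ℝ) : ℂ :=
  (w₁ + w₂) * Complex.I - (w₁ ^ 2 + w₂ ^ 2) / 2

variable (w₁ w₂ : ℝ)

lemma charRadicand_eq : charRadicand w₁ w₂ = 1 - 2 * charExponent w₁ w₂ := by
  simp only [charRadicand, charExponent]
  linear_combination 2 * Complex.I_sq

lemma charRadicand_re : (charRadicand w₁ w₂).re = w₁ ^ 2 + w₂ ^ 2 + 1 := by
  simp [charRadicand, pow_two]
  ring

lemma charRadicand_re_pos : 0 < (charRadicand w₁ w₂).re := by
  rw [charRadicand_re]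
  positivity

lemma charRadicand_ne_zero : charRadicand w₁ w₂ ≠ 0 := fun h => by
  simpa [h] using charRadicand_re_pos w₁ w₂

lemma productCharFun_sq : productCharFun w₁ w₂ ^ 2 = (charRadicand w₁ w₂)⁻¹ := by
  rw [productCharFun, ← charRadicand, div_pow, one_pow, one_div]
  congr 1
  simp

lemma Complex.ofReal_mul_cpow {r : ℝ} (hr : 0 < r) (z s : ℂ) (hz : z ≠ 0) :
    ((r : ℂ) * z) ^ s = (r : ℂ) ^ s * z ^ s := by
  have hr' : (r : ℂ) ≠ 0 := by exact_mod_cast hr.ne'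
  rw [Complex.cpow_def_of_ne_zero (mul_ne_zero hr' hz), Complex.cpow_def_of_ne_zero hr',
    Complex.cpow_def_of_ne_zero hz, Complex.log_ofReal_mul hr hz, Complex.ofReal_log hr.le,
    add_mul, Complex.exp_add]

lemma Complex.ofReal_sqrt_eq_cpow {r : ℝ} (hr : 0 ≤ r) :
    ((√r : ℝ) : ℂ) = (r : ℂ) ^ (1 / 2 : ℂ) := by
  rw [Real.sqrt_eq_rpow, Complex.ofReal_cpow hr]
  simp

/-- The value of the Gaussian integral with parameter `q / 2`, where `q` is the radicand. As `q` has
positive real part, the principal square root commutes with inversion. -/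
lemma cpow_two_pi_div_charRadicand :
    (Real.pi / (charRadicand w₁ w₂ / 2)) ^ (1 / 2 : ℂ) =
      √(2 * Real.pi) * productCharFun w₁ w₂ := by
  have h1 : (Real.pi / (charRadicand w₁ w₂ / 2) : ℂ) =
      ((2 * Real.pi : ℝ) : ℂ) * (charRadicand w₁ w₂)⁻¹ := by
    have := charRadicand_ne_zero w₁ w₂
    push_cast
    field_simp
  have harg : (charRadicand w₁ w₂).arg ≠ Real.pi := fun h => by
    have := (Complex.arg_eq_pi_iff.1 h).1
    linarith [charRadicand_re_pos w₁ w₂]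
  rw [h1, Complex.ofReal_mul_cpow (by positivity) _ _ (inv_ne_zero (charRadicand_ne_zero _ _)),
    Complex.ofReal_sqrt_eq_cpow (by positivity), Complex.inv_cpow _ _ harg, productCharFun,
    ← charRadicand, one_div (_ ^ _)]

lemma half_charRadicand_re_pos : 0 < (charRadicand w₁ w₂ / 2).re := by
  have := charRadicand_re_pos w₁ w₂
  rw [Complex.div_ofNat_re]
  linarith

lemma ofReal_exp_mul_cexp (r : ℝ) :
    ((Real.exp (-r ^ 2 / 2) : ℝ) : ℂ) * Complex.exp (charExponent w₁ w₂ * (r : ℂ) ^ 2) =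
      Complex.exp (-(charRadicand w₁ w₂ / 2) * (r : ℂ) ^ 2) := by
  rw [charRadicand_eq]
  push_cast
  rw [← Complex.exp_add]
  ring_nf

lemma sqrt_two_div_pi_mul_sqrt_two_pi : √(2 / Real.pi) * √(2 * Real.pi) = 2 := by
  rw [← Real.sqrt_mul (by positivity), Real.sqrt_eq_iff_mul_self_eq (by positivity) (by norm_num)]
  field_simp

/-- Averaging `exp (s r ^ 2)` over the half-normal law of `r`, the law of the absolute value of a
standard normal variable. -/
lemma integral_halfNormal_mul_cexp :
    ∫ r in Set.Ioi (0 : ℝ), ((√(2 / Real.pi) * Real.exp (-r ^ 2 / 2) : ℝ) : ℂ) *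
      Complex.exp (charExponent w₁ w₂ * (r : ℂ) ^ 2) = productCharFun w₁ w₂ := by
  simp_rw [Complex.ofReal_mul, mul_assoc, ofReal_exp_mul_cexp]
  rw [integral_const_mul, integral_gaussian_complex_Ioi (half_charRadicand_re_pos w₁ w₂),
    cpow_two_pi_div_charRadicand]
  have : ((√(2 / Real.pi) : ℝ) : ℂ) * ((√(2 * Real.pi) : ℝ) : ℂ) = 2 := by
    exact_mod_cast sqrt_two_div_pi_mul_sqrt_two_pi
  linear_combination productCharFun w₁ w₂ / 2 * this

lemma integral_gaussianReal_cexp :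
    ∫ r, Complex.exp (charExponent w₁ w₂ * (r : ℂ) ^ 2) ∂(gaussianReal 0 1) =
      productCharFun w₁ w₂ := by
  rw [integral_gaussianReal_eq_integral_smul one_ne_zero]
  have : ∀ r : ℝ, gaussianPDFReal 0 1 r • Complex.exp (charExponent w₁ w₂ * (r : ℂ) ^ 2) =
      ((√(2 * Real.pi))⁻¹ : ℝ) * Complex.exp (-(charRadicand w₁ w₂ / 2) * (r : ℂ) ^ 2) := by
    intro r
    rw [← ofReal_exp_mul_cexp, gaussianPDFReal, Complex.real_smul]
    simp [mul_assoc]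
  simp_rw [this]
  rw [integral_const_mul, integral_gaussian_complex (half_charRadicand_re_pos w₁ w₂),
    cpow_two_pi_div_charRadicand, ← mul_assoc, ← Complex.ofReal_mul,
    inv_mul_cancel₀ (by positivity), Complex.ofReal_one, one_mul]

lemma integrableOn_sq_mul_exp_neg_mul_sq {b : ℝ} (hb : 0 < b) :
    IntegrableOn (fun r : ℝ => r ^ 2 * Real.exp (-b * r ^ 2)) (Set.Ioi 0) := by
  have := (integrable_rpow_mul_exp_neg_mul_sq hb (s := 2) (by norm_num)).integrableOn
    (s := Set.Ioi 0)
  simpa using this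

/-- Integration by parts, with antiderivative `r exp (-b r ^ 2)`. -/
lemma integral_sq_mul_cexp_neg_mul_sq {b : ℂ} (hb : 0 < b.re) :
    ∫ r in Set.Ioi (0 : ℝ), (r : ℂ) ^ 2 * Complex.exp (-b * (r : ℂ) ^ 2) =
      (2 * b)⁻¹ * ∫ r in Set.Ioi (0 : ℝ), Complex.exp (-b * (r : ℂ) ^ 2) := by
  have hb0 : b ≠ 0 := fun h => by simp [h] at hb
  have h1 : IntegrableOn (fun r : ℝ => Complex.exp (-b * (r : ℂ) ^ 2)) (Set.Ioi 0) :=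
    (integrable_cexp_neg_mul_sq hb).integrableOn
  have h2 : IntegrableOn (fun r : ℝ => (r : ℂ) ^ 2 * Complex.exp (-b * (r : ℂ) ^ 2))
      (Set.Ioi 0) := by
    refine (integrable_norm_iff (by fun_prop)).1 ?_
    refine (integrableOn_sq_mul_exp_neg_mul_sq hb).congr (.of_forall fun r => ?_)
    simp only
    rw [norm_mul, norm_pow, Complex.norm_real, norm_cexp_neg_mul_sq, Real.norm_eq_abs, sq_abs]
  have hd : ∀ r : ℝ, HasDerivAt (fun r : ℝ => (r : ℂ) * Complex.exp (-b * (r : ℂ) ^ 2))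
      (Complex.exp (-b * (r : ℂ) ^ 2) - 2 * b * ((r : ℂ) ^ 2 * Complex.exp (-b * (r : ℂ) ^ 2)))
      r := by
    intro r
    have hr : HasDerivAt (fun r : ℝ => (r : ℂ)) 1 r := Complex.ofRealCLM.hasDerivAt
    refine (hr.mul ((hr.pow 2).const_mul (-b)).cexp).congr_deriv ?_
    simp
    ring
  have hlim : Filter.Tendsto (fun r : ℝ => (r : ℂ) * Complex.exp (-b * (r : ℂ) ^ 2))
      Filter.atTop (nhds 0) := by
    rw [tendsto_zero_iff_norm_tendsto_zero]
    have h := (rpow_mul_exp_neg_mul_sq_isLittleO_exp_neg hb 1).tendsto_zero_of_tendsto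
      (Real.tendsto_exp_neg_atTop_nhds_zero.comp
        (Filter.tendsto_id.const_mul_atTop (by norm_num : (0 : ℝ) < 1 / 2)) |>.congr fun x => by
          simp)
    refine h.congr' ?_
    filter_upwards [Filter.eventually_gt_atTop 0] with r hr
    simp only [neg_mul, Real.rpow_one, norm_mul, Complex.norm_real, Real.norm_eq_abs,
      abs_of_pos hr]
    rw [← neg_mul, ← neg_mul, norm_cexp_neg_mul_sq]
  have := integral_Ioi_of_hasDerivAt_of_tendsto' (a := 0) (fun r _ => hd r)
    (h1.sub (h2.const_mul (2 * b))) hlim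
  rw [integral_sub h1 (h2.const_mul _), integral_const_mul] at this
  simp only [Complex.ofReal_zero, zero_mul, sub_zero] at this
  rw [sub_eq_zero.1 this, ← mul_assoc, inv_mul_cancel₀ (by simpa using hb0), one_mul]

/-- Averaging `exp (s r ^ 2)` over the Maxwell law of `r`, the law of the length of a standard normal
vector in dimension three. The factor `r ^ 2` multiplies the half-normal average by `1 / q = F ^ 2`,
where `q` is the radicand. -/
lemma integral_maxwell_mul_cexp :
    ∫ r in Set.Ioi (0 : ℝ), ((√(2 / Real.pi) * r ^ 2 * Real.exp (-r ^ 2 / 2) : ℝ) : ℂ) *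
      Complex.exp (charExponent w₁ w₂ * (r : ℂ) ^ 2) = productCharFun w₁ w₂ ^ 3 := by
  have h0 := integral_halfNormal_mul_cexp w₁ w₂
  simp_rw [Complex.ofReal_mul, mul_assoc, ofReal_exp_mul_cexp] at h0 ⊢
  rw [integral_const_mul] at h0 ⊢
  simp_rw [Complex.ofReal_pow]
  rw [integral_sq_mul_cexp_neg_mul_sq (half_charRadicand_re_pos w₁ w₂), mul_left_comm, h0,
    pow_succ, productCharFun_sq]
  congr 2
  ring

end ComplexGaussian

/-! ### Gaussian mixtures and their Fourier transforms -/

section Mixture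

/-- The density of two independent normal variables with mean and variance `r ^ 2`: the conditional
density of the pair of products given that the common vector has length `r`. -/
noncomputable def conditionalDensity (r : ℝ) (z : ℝ × ℝ) : ℝ :=
  gaussianPDFReal (r ^ 2) (r ^ 2).toNNReal z.1 * gaussianPDFReal (r ^ 2) (r ^ 2).toNNReal z.2

lemma measurable_uncurry_conditionalDensity :
    Measurable (fun p : ℝ × (ℝ × ℝ) => conditionalDensity p.1 p.2) := by
  unfold conditionalDensity gaussianPDFReal
  fun_prop

lemma conditionalDensity_nonneg (r : ℝ) (z : ℝ × ℝ) : 0 ≤ conditionalDensity r z :=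
  mul_nonneg (gaussianPDFReal_nonneg _ _ _) (gaussianPDFReal_nonneg _ _ _)

lemma integrable_conditionalDensity (r : ℝ) : Integrable (conditionalDensity r) :=
  (integrable_gaussianPDFReal _ _).mul_prod (integrable_gaussianPDFReal _ _)

lemma toNNReal_sq_ne_zero {r : ℝ} (hr : r ≠ 0) : (r ^ 2).toNNReal ≠ 0 := by
  simpa using hr

lemma integral_conditionalDensity {r : ℝ} (hr : r ≠ 0) : ∫ z, conditionalDensity r z = 1 := by
  have h := integral_prod_mul (μ := (volume : Measure ℝ)) (ν := (volume : Measure ℝ))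
    (gaussianPDFReal (r ^ 2) (r ^ 2).toNNReal) (gaussianPDFReal (r ^ 2) (r ^ 2).toNNReal)
  rw [integral_gaussianPDFReal_eq_one _ (toNNReal_sq_ne_zero hr), one_mul] at h
  exact h

lemma integral_cexp_mul_gaussianPDFReal {r : ℝ} (hr : r ≠ 0) (w : ℝ) :
    ∫ x : ℝ, Complex.exp (w * x * Complex.I) * (gaussianPDFReal (r ^ 2) (r ^ 2).toNNReal x : ℂ) =
      Complex.exp ((w * Complex.I - w ^ 2 / 2) * (r : ℂ) ^ 2) := by
  have h := charFun_gaussianReal (μ := r ^ 2) (v := (r ^ 2).toNNReal) w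
  rw [charFun_apply_real, integral_gaussianReal_eq_integral_smul (toNNReal_sq_ne_zero hr)] at h
  simp_rw [Complex.real_smul] at h
  simp_rw [mul_comm (Complex.exp _)]
  rw [h, Real.coe_toNNReal _ (sq_nonneg r)]
  congr 1
  push_cast
  ring

lemma fourierKernel_eq_mul (w₁ w₂ : ℝ) (z : ℝ × ℝ) :
    fourierKernel w₁ w₂ z =
      Complex.exp (w₁ * z.1 * Complex.I) * Complex.exp (w₂ * z.2 * Complex.I) := by
  rw [fourierKernel, ← Complex.exp_add]
  congr 1
  push_cast
  ring

lemma norm_fourierKernel (w₁ w₂ : ℝ) (z : ℝ × ℝ) : ‖fourierKernel w₁ w₂ z‖ = 1 := by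
  rw [fourierKernel, mul_comm, Complex.norm_exp_ofReal_mul_I]

lemma continuous_fourierKernel (w₁ w₂ : ℝ) : Continuous (fourierKernel w₁ w₂) := by
  unfold fourierKernel
  fun_prop

lemma integral_fourierKernel_mul_conditionalDensity {r : ℝ} (hr : r ≠ 0) (w₁ w₂ : ℝ) :
    ∫ z, fourierKernel w₁ w₂ z * (conditionalDensity r z : ℂ) =
      Complex.exp (charExponent w₁ w₂ * (r : ℂ) ^ 2) := by
  have h := integral_prod_mul (μ := (volume : Measure ℝ)) (ν := (volume : Measure ℝ))
    (fun x : ℝ =>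
      Complex.exp (w₁ * x * Complex.I) * (gaussianPDFReal (r ^ 2) (r ^ 2).toNNReal x : ℂ))
    (fun x : ℝ =>
      Complex.exp (w₂ * x * Complex.I) * (gaussianPDFReal (r ^ 2) (r ^ 2).toNNReal x : ℂ))
  rw [integral_cexp_mul_gaussianPDFReal hr, integral_cexp_mul_gaussianPDFReal hr,
    ← Complex.exp_add] at h
  have h' : ∀ z : ℝ × ℝ, fourierKernel w₁ w₂ z * (conditionalDensity r z : ℂ) =
      Complex.exp (w₁ * z.1 * Complex.I) *
        (gaussianPDFReal (r ^ 2) (r ^ 2).toNNReal z.1 : ℂ) *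
      (Complex.exp (w₂ * z.2 * Complex.I) *
        (gaussianPDFReal (r ^ 2) (r ^ 2).toNNReal z.2 : ℂ)) := fun z => by
    rw [fourierKernel_eq_mul, conditionalDensity]
    push_cast
    ring
  simp_rw [h']
  refine h.trans ?_
  rw [charExponent]
  congr 1
  ring

variable {m : ℝ → ℝ} {h : ℝ × ℝ → ℝ}

lemma integrable_mul_conditionalDensity (hmeas : Measurable m)
    (hint : IntegrableOn m (Set.Ioi 0)) :
    Integrable (fun p : ℝ × (ℝ × ℝ) => m p.1 * conditionalDensity p.1 p.2)
      ((volume.restrict (Set.Ioi 0)).prod volume) := by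
  rw [integrable_prod_iff]
  · refine ⟨.of_forall fun r => (integrable_conditionalDensity r).const_mul (m r), ?_⟩
    refine hint.norm.congr ?_
    filter_upwards [ae_restrict_mem measurableSet_Ioi] with r hr
    simp_rw [norm_mul, Real.norm_of_nonneg (conditionalDensity_nonneg _ _)]
    rw [integral_const_mul, integral_conditionalDensity (ne_of_gt hr), mul_one]
  · exact ((hmeas.comp measurable_fst).mul
      measurable_uncurry_conditionalDensity).aestronglyMeasurable

/-- The mixture formula is only required away from the origin, where `productDensity` is
singular. -/
lemma integrable_of_mixture (hmeas : Measurable m) (hint : IntegrableOn m (Set.Ioi 0))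
    (hh : ∀ z ≠ 0, ∫ r in Set.Ioi (0 : ℝ), m r * conditionalDensity r z = h z) :
    Integrable h := by
  refine (integrable_mul_conditionalDensity hmeas hint).integral_prod_right.congr ?_
  filter_upwards [Measure.ae_ne volume (0 : ℝ × ℝ)] with z hz using hh z hz

lemma integrable_fourierKernel_mul (hint : Integrable h) (w₁ w₂ : ℝ) :
    Integrable (fun z => fourierKernel w₁ w₂ z * (h z : ℂ)) :=
  hint.ofReal.bdd_mul (continuous_fourierKernel w₁ w₂).aestronglyMeasurable
    (.of_forall fun z => (norm_fourierKernel w₁ w₂ z).le)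

/-- The Fourier transform of a mixture of the conditional densities is the mixture of their
Fourier transforms. -/
lemma integral_fourierKernel_mul_of_mixture (hmeas : Measurable m)
    (hint : IntegrableOn m (Set.Ioi 0))
    (hh : ∀ z ≠ 0, ∫ r in Set.Ioi (0 : ℝ), m r * conditionalDensity r z = h z) (w₁ w₂ : ℝ) :
    ∫ z, fourierKernel w₁ w₂ z * (h z : ℂ) =
      ∫ r in Set.Ioi (0 : ℝ), (m r : ℂ) * Complex.exp (charExponent w₁ w₂ * (r : ℂ) ^ 2) := by
  have hF : Integrable (Function.uncurry fun (r : ℝ) (z : ℝ × ℝ) =>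
      fourierKernel w₁ w₂ z * ((m r * conditionalDensity r z : ℝ) : ℂ))
      ((volume.restrict (Set.Ioi 0)).prod volume) :=
    (integrable_mul_conditionalDensity hmeas hint).ofReal.bdd_mul
      ((continuous_fourierKernel w₁ w₂).comp continuous_snd).aestronglyMeasurable
      (.of_forall fun p => (norm_fourierKernel w₁ w₂ p.2).le)
  calc
    _ = ∫ z, ∫ r in Set.Ioi (0 : ℝ),
          fourierKernel w₁ w₂ z * ((m r * conditionalDensity r z : ℝ) : ℂ) := by
      refine integral_congr_ae ?_
      filter_upwards [Measure.ae_ne volume (0 : ℝ × ℝ)] with z hz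
      rw [integral_const_mul, integral_complex_ofReal, hh z hz]
    _ = ∫ r in Set.Ioi (0 : ℝ), ∫ z,
          fourierKernel w₁ w₂ z * ((m r * conditionalDensity r z : ℝ) : ℂ) :=
      (integral_integral_swap hF).symm
    _ = _ := by
      refine setIntegral_congr_fun measurableSet_Ioi fun r hr => ?_
      simp_rw [Complex.ofReal_mul, mul_left_comm (fourierKernel _ _ _)]
      rw [integral_const_mul, integral_fourierKernel_mul_conditionalDensity (ne_of_gt hr)]

/-- Completing the squares brings the mixing integrand into Cauchy–Schlömilch form. -/
lemma exp_mul_conditionalDensity {r : ℝ} (hr : 0 < r) (z : ℝ × ℝ) :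
    Real.exp (-r ^ 2 / 2) * conditionalDensity r z =
      1 / (2 * Real.pi) * Real.exp (z.1 + z.2) * ((r ^ 2)⁻¹ *
        Real.exp (-(√(3 / 2) ^ 2 * r ^ 2 + (√(z.1 ^ 2 + z.2 ^ 2) / √2) ^ 2 / r ^ 2))) := by
  rw [conditionalDensity, gaussianPDFReal, gaussianPDFReal, Real.coe_toNNReal _ (sq_nonneg r),
    div_pow, Real.sq_sqrt (by positivity), Real.sq_sqrt (by positivity),
    Real.sq_sqrt (by positivity)]
  have h1 : (√(2 * Real.pi * r ^ 2))⁻¹ * (√(2 * Real.pi * r ^ 2))⁻¹ =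
      1 / (2 * Real.pi) * (r ^ 2)⁻¹ := by
    rw [← mul_inv, Real.mul_self_sqrt (by positivity)]
    field_simp
  have h2 : Real.exp (-r ^ 2 / 2) * (Real.exp (-(z.1 - r ^ 2) ^ 2 / (2 * r ^ 2)) *
      Real.exp (-(z.2 - r ^ 2) ^ 2 / (2 * r ^ 2))) = Real.exp (z.1 + z.2) *
      Real.exp (-(3 / 2 * r ^ 2 + (z.1 ^ 2 + z.2 ^ 2) / 2 / r ^ 2)) := by
    simp_rw [← Real.exp_add]
    congr 1
    field_simp
    ring
  linear_combination Real.exp (-r ^ 2 / 2) * (Real.exp (-(z.1 - r ^ 2) ^ 2 / (2 * r ^ 2)) *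
      Real.exp (-(z.2 - r ^ 2) ^ 2 / (2 * r ^ 2))) * h1 + 1 / (2 * Real.pi) * (r ^ 2)⁻¹ * h2

lemma sq_add_sq_pos_of_ne_zero {z : ℝ × ℝ} (hz : z ≠ 0) : 0 < z.1 ^ 2 + z.2 ^ 2 := by
  by_contra hc
  have h1 : z.1 = 0 := by nlinarith [sq_nonneg z.1, sq_nonneg z.2]
  have h2 : z.2 = 0 := by nlinarith [sq_nonneg z.1, sq_nonneg z.2]
  exact hz (Prod.ext h1 h2)

lemma two_mul_sqrt_mul_div (s : ℝ) : 2 * √(3 / 2) * (s / √2) = √3 * s := by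
  rw [Real.sqrt_div (by norm_num)]
  have : √2 * √2 = 2 := Real.mul_self_sqrt (by norm_num)
  field_simp
  linear_combination -s * this

/-- Given the length of a one-dimensional standard normal variable, the products are
conditionally normal; mixing over the half-normal length gives `productDensity`. -/
lemma integral_halfNormal_mul_conditionalDensity {z : ℝ × ℝ} (hz : z ≠ 0) :
    ∫ r in Set.Ioi (0 : ℝ), √(2 / Real.pi) * Real.exp (-r ^ 2 / 2) * conditionalDensity r z =
      productDensity z := by
  have hs : 0 < √(z.1 ^ 2 + z.2 ^ 2) := Real.sqrt_pos.2 (sq_add_sq_pos_of_ne_zero hz)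
  rw [setIntegral_congr_fun measurableSet_Ioi fun r hr =>
    (mul_assoc _ _ _).trans (congrArg _ (exp_mul_conditionalDensity hr z)), integral_const_mul,
    integral_const_mul, integral_inv_sq_mul_exp_neg_add_div (by positivity) (by positivity),
    two_mul_sqrt_mul_div, productDensity, sub_eq_add_neg, Real.exp_add (z.1 + z.2)]
  have h2 : √2 * √2 = 2 := Real.mul_self_sqrt (by norm_num)
  rw [Real.sqrt_div (by norm_num)]
  field_simp
  linear_combination h2

/-- In dimension three the Maxwell density cancels the factor `r ^ (-2)` of the conditional density,
and the mixture is `pinnedDensity`. -/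
lemma integral_maxwell_mul_conditionalDensity {z : ℝ × ℝ} (hz : z ≠ 0) :
    ∫ r in Set.Ioi (0 : ℝ),
      √(2 / Real.pi) * r ^ 2 * Real.exp (-r ^ 2 / 2) * conditionalDensity r z =
      pinnedDensity z := by
  have hs : 0 < √(z.1 ^ 2 + z.2 ^ 2) := Real.sqrt_pos.2 (sq_add_sq_pos_of_ne_zero hz)
  have hcongr : ∀ r ∈ Set.Ioi (0 : ℝ),
      √(2 / Real.pi) * r ^ 2 * Real.exp (-r ^ 2 / 2) * conditionalDensity r z =
      √(2 / Real.pi) * (1 / (2 * Real.pi) * Real.exp (z.1 + z.2) *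
        Real.exp (-(√(3 / 2) ^ 2 * r ^ 2 + (√(z.1 ^ 2 + z.2 ^ 2) / √2) ^ 2 / r ^ 2))) := by
    intro r hr
    have hr' : 0 < r := hr
    rw [mul_assoc (√(2 / Real.pi) * r ^ 2), exp_mul_conditionalDensity hr]
    field_simp
  rw [setIntegral_congr_fun measurableSet_Ioi hcongr, integral_const_mul,
    integral_const_mul, integral_exp_neg_add_div (by positivity) (by positivity),
    two_mul_sqrt_mul_div, pinnedDensity, sub_eq_add_neg, Real.exp_add (z.1 + z.2)]
  have h2 : √2 * √2 = 2 := Real.mul_self_sqrt (by norm_num)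
  rw [Real.sqrt_div (by norm_num), Real.sqrt_div (by norm_num)]
  field_simp
  linear_combination h2

lemma integrableOn_halfNormal :
    IntegrableOn (fun r : ℝ => √(2 / Real.pi) * Real.exp (-r ^ 2 / 2)) (Set.Ioi 0) := by
  refine Integrable.congr ((integrable_exp_neg_mul_sq (b := 1 / 2) (by norm_num)).const_mul
    (√(2 / Real.pi))).integrableOn (.of_forall fun r => ?_)
  simp only
  ring_nf

lemma integrableOn_maxwell :
    IntegrableOn (fun r : ℝ => √(2 / Real.pi) * r ^ 2 * Real.exp (-r ^ 2 / 2)) (Set.Ioi 0) := by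
  refine Integrable.congr ((integrableOn_sq_mul_exp_neg_mul_sq (b := 1 / 2) (by norm_num)).const_mul
    (√(2 / Real.pi))) (.of_forall fun r => ?_)
  simp only
  ring_nf

lemma integrable_productDensity : Integrable productDensity :=
  integrable_of_mixture (by fun_prop) integrableOn_halfNormal
    fun _ => integral_halfNormal_mul_conditionalDensity

lemma integrable_pinnedDensity : Integrable pinnedDensity :=
  integrable_of_mixture (by fun_prop) integrableOn_maxwell
    fun _ => integral_maxwell_mul_conditionalDensity

lemma integral_fourierKernel_mul_productDensity (w₁ w₂ : ℝ) :
    ∫ z, fourierKernel w₁ w₂ z * (productDensity z : ℂ) = productCharFun w₁ w₂ :=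
  (integral_fourierKernel_mul_of_mixture (by fun_prop) integrableOn_halfNormal
    (fun _ => integral_halfNormal_mul_conditionalDensity) w₁ w₂).trans
    (integral_halfNormal_mul_cexp w₁ w₂)

lemma integral_fourierKernel_mul_pinnedDensity (w₁ w₂ : ℝ) :
    ∫ z, fourierKernel w₁ w₂ z * (pinnedDensity z : ℂ) = productCharFun w₁ w₂ ^ 3 :=
  (integral_fourierKernel_mul_of_mixture (by fun_prop) integrableOn_maxwell
    (fun _ => integral_maxwell_mul_conditionalDensity) w₁ w₂).trans
    (integral_maxwell_mul_cexp w₁ w₂)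

end Mixture

/-! ### The laws of the products -/

section Law

/-- Every continuous linear form on `ℝ × ℝ` is `z ↦ w₁ z₁ + w₂ z₂`, so the integrals of
`fourierKernel` are the values of the characteristic function. -/
lemma Measure.ext_of_integral_fourierKernel {μ ν : Measure (ℝ × ℝ)} [IsFiniteMeasure μ]
    [IsFiniteMeasure ν]
    (h : ∀ w₁ w₂ : ℝ, ∫ z, fourierKernel w₁ w₂ z ∂μ = ∫ z, fourierKernel w₁ w₂ z ∂ν) : μ = ν := by
  refine Measure.ext_of_charFunDual (funext fun L => ?_)
  have hL : ∀ z : ℝ × ℝ, Complex.exp (L z * Complex.I) = fourierKernel (L (1, 0)) (L (0, 1)) z := by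
    intro z
    have hz : z = z.1 • ((1 : ℝ), (0 : ℝ)) + z.2 • ((0 : ℝ), (1 : ℝ)) := by ext <;> simp
    conv_lhs => rw [hz, map_add, map_smul, map_smul]
    rw [fourierKernel]
    congr 1
    push_cast [smul_eq_mul]
    ring
  simp_rw [charFunDual_apply, hL]
  exact h _ _

lemma hasLaw_withDensity_of_fourierKernel {Ω : Type*} [MeasurableSpace Ω] {P : Measure Ω}
    [IsProbabilityMeasure P] {Z : Ω → ℝ × ℝ} (hZ : AEMeasurable Z P) {h : ℝ × ℝ → ℝ}
    (hmeas : Measurable h) (hnonneg : ∀ z, 0 ≤ h z) (hint : Integrable h)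
    (heq : ∀ w₁ w₂ : ℝ, ∫ ω, fourierKernel w₁ w₂ (Z ω) ∂P =
      ∫ z, fourierKernel w₁ w₂ z * (h z : ℂ)) :
    HasLaw Z ((volume : Measure (ℝ × ℝ)).withDensity fun z => ENNReal.ofReal (h z)) P where
  aemeasurable := hZ
  map_eq := by
    have := Measure.isProbabilityMeasure_map hZ
    have := isFiniteMeasure_withDensity_ofReal hint.hasFiniteIntegral
    refine Measure.ext_of_integral_fourierKernel fun w₁ w₂ => ?_
    rw [integral_map hZ (continuous_fourierKernel w₁ w₂).aestronglyMeasurable, heq,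
      integral_withDensity_eq_integral_toReal_smul hmeas.ennreal_ofReal
        (.of_forall fun _ => ENNReal.ofReal_lt_top)]
    refine integral_congr_ae (.of_forall fun z => ?_)
    simp only
    rw [ENNReal.toReal_ofReal (hnonneg z), Complex.real_smul, mul_comm]

lemma hasLaw_coordinate {Ω : Type*} [MeasurableSpace Ω] {P : Measure Ω}
    {A : Ω → EuclideanSpace ℝ (Fin 3)}
    (hA : HasLaw A (stdGaussian (EuclideanSpace ℝ (Fin 3))) P) (k : Fin 3) :
    HasLaw (fun ω => A ω k) (gaussianReal 0 1) P := by
  have h : HasLaw (fun x : EuclideanSpace ℝ (Fin 3) => x k) (gaussianReal 0 1)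
      (stdGaussian (EuclideanSpace ℝ (Fin 3))) := by
    refine ⟨by fun_prop, ?_⟩
    rw [← map_pi_eq_stdGaussian, Measure.map_map (by fun_prop) (by fun_prop)]
    exact (measurePreserving_eval (fun _ : Fin 3 => gaussianReal 0 1) k).map_eq
  exact h.fun_comp hA

variable {Ω : Type*} [MeasurableSpace Ω] {P : Measure Ω} [IsProbabilityMeasure P]

lemma iIndepFun.hasLaw_prod_prod {E : Type*} [MeasurableSpace E] {μ : Measure E}
    {A B C : Ω → E} (hA : HasLaw A μ P) (hB : HasLaw B μ P) (hC : HasLaw C μ P)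
    (hABC : iIndepFun ![A, B, C] P) :
    HasLaw (fun ω => (A ω, B ω, C ω)) (μ.prod (μ.prod μ)) P := by
  have := hA.isProbabilityMeasure_iff.1 inferInstance
  have hm : ∀ i, AEMeasurable (![A, B, C] i) P := by
    intro i
    fin_cases i
    exacts [hA.aemeasurable, hB.aemeasurable, hC.aemeasurable]
  have hBC : HasLaw (fun ω => (B ω, C ω)) (μ.prod μ) P :=
    (indepFun_iff_hasLaw_prodMk_prod hB hC).1
      (hABC.indepFun (i := 1) (j := 2) (by decide))
  exact (indepFun_iff_hasLaw_prodMk_prod hA hBC).1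
    (hABC.indepFun_prodMk₀ hm 1 2 0 (by decide) (by decide)).symm

/-- Conditionally on the common vector `A`, the two inner products are independent normal
variables, so their joint characteristic function only involves `‖A‖`. -/
lemma integral_fourierKernel_inner {E : Type*} [NormedAddCommGroup E] [InnerProductSpace ℝ E]
    [MeasurableSpace E] [BorelSpace E] [SecondCountableTopology E] {μ : Measure E}
    [IsProbabilityMeasure μ] (hμ : ∀ t : E, charFun μ t = Complex.exp (-‖t‖ ^ 2 / 2))
    {A B C : Ω → E} (hA : HasLaw A μ P) (hB : HasLaw B μ P) (hC : HasLaw C μ P)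
    (hABC : iIndepFun ![A, B, C] P) (w₁ w₂ : ℝ) :
    ∫ ω, fourierKernel w₁ w₂ (inner ℝ (B ω - A ω) (-A ω), inner ℝ (C ω - A ω) (-A ω)) ∂P =
      ∫ a, Complex.exp (charExponent w₁ w₂ * (‖a‖ : ℂ) ^ 2) ∂μ := by
  have hcont : Continuous fun p : E × E × E => fourierKernel w₁ w₂
      (inner ℝ (p.2.1 - p.1) (-p.1), inner ℝ (p.2.2 - p.1) (-p.1)) :=
    (continuous_fourierKernel w₁ w₂).comp (by fun_prop)
  have hint : Integrable (fun p : E × E × E => fourierKernel w₁ w₂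
      (inner ℝ (p.2.1 - p.1) (-p.1), inner ℝ (p.2.2 - p.1) (-p.1))) (μ.prod (μ.prod μ)) :=
    (integrable_const (1 : ℝ)).mono' hcont.aestronglyMeasurable
      (.of_forall fun p => (norm_fourierKernel _ _ _).le)
  refine ((iIndepFun.hasLaw_prod_prod hA hB hC hABC).integral_comp
    hcont.aestronglyMeasurable).trans ?_
  rw [integral_prod _ hint]
  refine integral_congr_ae (.of_forall fun a => ?_)
  have hsplit : ∀ q : E × E,
      fourierKernel w₁ w₂ (inner ℝ (q.1 - a) (-a), inner ℝ (q.2 - a) (-a)) =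
      Complex.exp ((w₁ + w₂) * (‖a‖ : ℂ) ^ 2 * Complex.I) *
        (Complex.exp (inner ℝ q.1 (-w₁ • a) * Complex.I) *
          Complex.exp (inner ℝ q.2 (-w₂ • a) * Complex.I)) := by
    intro q
    rw [fourierKernel, ← Complex.exp_add, ← Complex.exp_add]
    congr 1
    simp only [inner_neg_right, inner_sub_left, real_inner_self_eq_norm_sq, inner_smul_right]
    push_cast
    ring
  simp only
  simp_rw [hsplit]
  rw [integral_const_mul, integral_prod_mul (fun x : E => Complex.exp (inner ℝ x (-w₁ • a) *
    Complex.I)) (fun x : E => Complex.exp (inner ℝ x (-w₂ • a) * Complex.I)), ← charFun_apply,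
    ← charFun_apply, hμ, hμ, ← Complex.exp_add, ← Complex.exp_add, charExponent]
  congr 1
  simp only [norm_smul, Real.norm_eq_abs, abs_neg, Complex.ofReal_mul, mul_pow,
    ← Complex.ofReal_pow, sq_abs]
  push_cast
  ring

/-- The squared norm is a sum over coordinates, which are independent. -/
lemma integral_stdGaussian_cexp (w₁ w₂ : ℝ) :
    ∫ a : EuclideanSpace ℝ (Fin 3), Complex.exp (charExponent w₁ w₂ * (‖a‖ : ℂ) ^ 2)
      ∂(stdGaussian (EuclideanSpace ℝ (Fin 3))) = productCharFun w₁ w₂ ^ 3 := by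
  rw [← map_pi_eq_stdGaussian, integral_map (by fun_prop) (by fun_prop)]
  have h : ∀ x : Fin 3 → ℝ,
      Complex.exp (charExponent w₁ w₂ * (‖WithLp.toLp 2 x‖ : ℂ) ^ 2) =
        ∏ i, Complex.exp (charExponent w₁ w₂ * (x i : ℂ) ^ 2) := by
    intro x
    rw [← Complex.exp_sum, ← Finset.mul_sum, ← Complex.ofReal_pow, EuclideanSpace.real_norm_sq_eq]
    push_cast
    rfl
  simp_rw [h]
  rw [integral_fintype_prod_eq_prod
    (f := fun (_ : Fin 3) (x : ℝ) => Complex.exp (charExponent w₁ w₂ * (x : ℂ) ^ 2))]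
  simp [integral_gaussianReal_cexp]

lemma productDensity_nonneg (z : ℝ × ℝ) : 0 ≤ productDensity z := by
  unfold productDensity
  positivity

lemma pinnedDensity_nonneg (z : ℝ × ℝ) : 0 ≤ pinnedDensity z := by
  unfold pinnedDensity
  positivity

lemma measurable_productDensity : Measurable productDensity := by
  unfold productDensity
  fun_prop

lemma measurable_pinnedDensity : Measurable pinnedDensity := by
  unfold pinnedDensity
  fun_prop

lemma hasLaw_coordinate_products {A B C : Ω → EuclideanSpace ℝ (Fin 3)}
    (hA : HasLaw A (stdGaussian (EuclideanSpace ℝ (Fin 3))) P)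
    (hB : HasLaw B (stdGaussian (EuclideanSpace ℝ (Fin 3))) P)
    (hC : HasLaw C (stdGaussian (EuclideanSpace ℝ (Fin 3))) P)
    (hABC : iIndepFun ![A, B, C] P) (k : Fin 3) :
    HasLaw (fun ω => ((B ω k - A ω k) * (-A ω k), (C ω k - A ω k) * (-A ω k)))
      ((volume : Measure (ℝ × ℝ)).withDensity fun z => ENNReal.ofReal (productDensity z)) P := by
  have hAk := hasLaw_coordinate hA k
  have hBk := hasLaw_coordinate hB k
  have hCk := hasLaw_coordinate hC k
  have hind : iIndepFun ![fun ω => A ω k, fun ω => B ω k, fun ω => C ω k] P := by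
    have h := hABC.comp (fun _ (x : EuclideanSpace ℝ (Fin 3)) => x k) (fun _ => by fun_prop)
    convert h using 1
    funext i
    fin_cases i <;> rfl
  have hm1 := hAk.aemeasurable
  have hm2 := hBk.aemeasurable
  have hm3 := hCk.aemeasurable
  refine hasLaw_withDensity_of_fourierKernel (by fun_prop) measurable_productDensity
    productDensity_nonneg integrable_productDensity fun w₁ w₂ => ?_
  rw [integral_fourierKernel_mul_productDensity, ← integral_gaussianReal_cexp]
  -- on `ℝ`, as a one-dimensional inner product space, `inner ℝ x y = y * x`
  have h := integral_fourierKernel_inner (μ := gaussianReal 0 1) (fun t => by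
    rw [charFun_gaussianReal]
    congr 1
    simp [← Complex.ofReal_pow]
    ring) hAk hBk hCk hind w₁ w₂
  simpa [← Complex.ofReal_pow, mul_comm] using h

lemma hasLaw_inner_products {A B C : Ω → EuclideanSpace ℝ (Fin 3)}
    (hA : HasLaw A (stdGaussian (EuclideanSpace ℝ (Fin 3))) P)
    (hB : HasLaw B (stdGaussian (EuclideanSpace ℝ (Fin 3))) P)
    (hC : HasLaw C (stdGaussian (EuclideanSpace ℝ (Fin 3))) P)
    (hABC : iIndepFun ![A, B, C] P) :
    HasLaw (fun ω => (inner ℝ (B ω - A ω) (-A ω), inner ℝ (C ω - A ω) (-A ω)))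
      ((volume : Measure (ℝ × ℝ)).withDensity fun z => ENNReal.ofReal (pinnedDensity z)) P := by
  have hm1 := hA.aemeasurable
  have hm2 := hB.aemeasurable
  have hm3 := hC.aemeasurable
  refine hasLaw_withDensity_of_fourierKernel (by fun_prop) measurable_pinnedDensity
    pinnedDensity_nonneg integrable_pinnedDensity fun w₁ w₂ => ?_
  rw [integral_fourierKernel_mul_pinnedDensity, ← integral_stdGaussian_cexp]
  exact integral_fourierKernel_inner charFun_stdGaussian hA hB hC hABC w₁ w₂

lemma setIntegral_quadrant_pinnedDensity :
    ∫ z in Set.Ioi (0 : ℝ) ×ˢ Set.Ioi (0 : ℝ), pinnedDensity z =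
      ∫ z₁ in Set.Ioi (0 : ℝ), ∫ z₂ in Set.Ioi (0 : ℝ), pinnedDensity (z₁, z₂) :=
  setIntegral_prod _ integrable_pinnedDensity.integrableOn

lemma prob_inner_products_pos {A B C : Ω → EuclideanSpace ℝ (Fin 3)}
    (hA : HasLaw A (stdGaussian (EuclideanSpace ℝ (Fin 3))) P)
    (hB : HasLaw B (stdGaussian (EuclideanSpace ℝ (Fin 3))) P)
    (hC : HasLaw C (stdGaussian (EuclideanSpace ℝ (Fin 3))) P)
    (hABC : iIndepFun ![A, B, C] P) :
    P.real {ω | 0 < inner ℝ (B ω - A ω) (-A ω) ∧ 0 < inner ℝ (C ω - A ω) (-A ω)} =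
      ∫ z in Set.Ioi (0 : ℝ) ×ˢ Set.Ioi (0 : ℝ), pinnedDensity z := by
  have hset : {z : ℝ × ℝ | 0 < z.1 ∧ 0 < z.2} = Set.Ioi 0 ×ˢ Set.Ioi 0 := rfl
  have hs : MeasurableSet (Set.Ioi (0 : ℝ) ×ˢ Set.Ioi (0 : ℝ)) :=
    measurableSet_Ioi.prod measurableSet_Ioi
  refine ((hasLaw_inner_products hA hB hC hABC).measureReal_eq
    (p := fun z : ℝ × ℝ => 0 < z.1 ∧ 0 < z.2) hs).trans ?_
  rw [hset, measureReal_def, withDensity_apply _ hs,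
    integral_eq_lintegral_of_nonneg_ae (.of_forall pinnedDensity_nonneg)
      measurable_pinnedDensity.aestronglyMeasurable]

end Law

/-! ### The integral over the quadrant in closed form -/

section Value

lemma sqrt_two_sq : √2 ^ 2 = (2 : ℝ) := Real.sq_sqrt (by norm_num)

lemma sqrt_three_sq : √3 ^ 2 = (3 : ℝ) := Real.sq_sqrt (by norm_num)

lemma sqrt_two_lt_sqrt_three : √2 < √3 := Real.sqrt_lt_sqrt (by norm_num) (by norm_num)

lemma sqrt_three_sub_sqrt_two_mul_cos_pos (t : ℝ) : 0 < √3 - √2 * Real.cos t := by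
  have := mul_le_mul_of_nonneg_left (Real.cos_le_one t) (Real.sqrt_nonneg 2)
  linarith [sqrt_two_lt_sqrt_three]

lemma cos_add_sin_eq (t : ℝ) :
    Real.cos t + Real.sin t = √2 * Real.cos (t - Real.pi / 4) := by
  rw [Real.cos_sub, Real.cos_pi_div_four, Real.sin_pi_div_four]
  linear_combination -(Real.cos t + Real.sin t) / 2 * sqrt_two_sq

lemma integral_mul_exp_neg_mul {c : ℝ} (hc : 0 < c) :
    ∫ r in Set.Ioi (0 : ℝ), r * Real.exp (-(c * r)) = (c ^ 2)⁻¹ := by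
  have h := Real.integral_rpow_mul_exp_neg_mul_Ioi (a := 2) (r := c) (by norm_num) hc
  norm_num [Real.Gamma_two] at h
  exact h

lemma pinnedDensity_polar {r : ℝ} (hr : 0 < r) (t : ℝ) :
    pinnedDensity (r * Real.cos t, r * Real.sin t) = 1 / (2 * √3 * Real.pi) *
      Real.exp (-((√3 - √2 * Real.cos (t - Real.pi / 4)) * r)) := by
  have : (r * Real.cos t) ^ 2 + (r * Real.sin t) ^ 2 = r ^ 2 := by
    linear_combination r ^ 2 * Real.cos_sq_add_sin_sq t
  rw [pinnedDensity, this, Real.sqrt_sq hr.le, ← mul_add, cos_add_sin_eq]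
  ring_nf

lemma mem_quadrant_polar_iff {r t : ℝ} (hr : 0 < r) (ht : t ∈ Set.Ioo (-Real.pi) Real.pi) :
    (r * Real.cos t, r * Real.sin t) ∈ Set.Ioi (0 : ℝ) ×ˢ Set.Ioi (0 : ℝ) ↔
      t ∈ Set.Ioo 0 (Real.pi / 2) := by
  simp only [Set.mem_prod, Set.mem_Ioi, mul_pos_iff_of_pos_left hr]
  constructor
  · rintro ⟨hcos, hsin⟩
    constructor
    · by_contra hc
      exact absurd (Real.sin_nonpos_of_nonpos_of_neg_pi_le (not_lt.1 hc) ht.1.le) (not_le.2 hsin)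
    · by_contra hc
      exact absurd (Real.cos_nonpos_of_pi_div_two_le_of_le (not_lt.1 hc)
        (by linarith [ht.2, Real.pi_pos])) (not_le.2 hcos)
  · rintro ⟨h0, h1⟩
    exact ⟨Real.cos_pos_of_mem_Ioo ⟨by linarith [Real.pi_pos], h1⟩,
      Real.sin_pos_of_pos_of_lt_pi h0 ht.2⟩

lemma setIntegral_quadrant_eq_polar :
    ∫ z in Set.Ioi (0 : ℝ) ×ˢ Set.Ioi (0 : ℝ), pinnedDensity z =
      ∫ t in (0 : ℝ)..(Real.pi / 2), 1 / (2 * √3 * Real.pi) *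
        ((√3 - √2 * Real.cos (t - Real.pi / 4)) ^ 2)⁻¹ := by
  have hs : MeasurableSet (Set.Ioi (0 : ℝ) ×ˢ Set.Ioi (0 : ℝ)) :=
    measurableSet_Ioi.prod measurableSet_Ioi
  set q : Set (ℝ × ℝ) := Set.Ioi (0 : ℝ) ×ˢ Set.Ioi (0 : ℝ) with hq
  set F : ℝ × ℝ → ℝ := fun p => p.1 * (1 / (2 * √3 * Real.pi) *
      Real.exp (-((√3 - √2 * Real.cos (p.2 - Real.pi / 4)) * p.1))) with hF
  -- the quadrant corresponds to the angles in `(0, π / 2)`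
  have hstep : ∫ z in q, pinnedDensity z =
      ∫ p in Set.Ioi (0 : ℝ) ×ˢ Set.Ioo 0 (Real.pi / 2), F p := by
    rw [← integral_indicator hs, ← integral_comp_polarCoord_symm]
    have hJsub : Set.Ioi (0 : ℝ) ×ˢ Set.Ioo 0 (Real.pi / 2) ⊆ polarCoord.target :=
      Set.prod_mono le_rfl (Set.Ioo_subset_Ioo (by linarith [Real.pi_pos])
        (by linarith [Real.pi_pos]))
    rw [← Set.inter_eq_right.2 hJsub, ← setIntegral_indicator
      (measurableSet_Ioi.prod measurableSet_Ioo)]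
    refine setIntegral_congr_fun polarCoord.open_target.measurableSet fun p hp => ?_
    obtain ⟨hr, ht⟩ : 0 < p.1 ∧ p.2 ∈ Set.Ioo (-Real.pi) Real.pi := hp
    by_cases hpJ : p.2 ∈ Set.Ioo 0 (Real.pi / 2)
    · have h1 : polarCoord.symm p ∈ q := (mem_quadrant_polar_iff hr ht).2 hpJ
      have h2 : p ∈ Set.Ioi (0 : ℝ) ×ˢ Set.Ioo 0 (Real.pi / 2) := ⟨hr, hpJ⟩
      simp only [Set.indicator_of_mem h1, Set.indicator_of_mem h2]
      rw [polarCoord_symm_apply, pinnedDensity_polar hr, smul_eq_mul]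
    · have h1 : polarCoord.symm p ∉ q := fun h => hpJ ((mem_quadrant_polar_iff hr ht).1 h)
      have h2 : p ∉ Set.Ioi (0 : ℝ) ×ˢ Set.Ioo 0 (Real.pi / 2) := fun h => hpJ h.2
      simp only [Set.indicator_of_notMem h1, Set.indicator_of_notMem h2, smul_zero]
  have hrad : ∀ t, ∫ r in Set.Ioi (0 : ℝ), F (r, t) =
      1 / (2 * √3 * Real.pi) * ((√3 - √2 * Real.cos (t - Real.pi / 4)) ^ 2)⁻¹ := by
    intro t
    simp only [hF, mul_left_comm _ (1 / (2 * √3 * Real.pi))]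
    rw [integral_const_mul, integral_mul_exp_neg_mul (sqrt_three_sub_sqrt_two_mul_cos_pos _)]
  have hint : Integrable F ((volume.restrict (Set.Ioi (0 : ℝ))).prod
      (volume.restrict (Set.Ioo 0 (Real.pi / 2)))) := by
    have hmeas : AEStronglyMeasurable F
        ((volume.restrict (Set.Ioi (0 : ℝ))).prod (volume.restrict (Set.Ioo 0 (Real.pi / 2)))) := by
      refine Continuous.aestronglyMeasurable ?_
      fun_prop
    rw [integrable_prod_iff' hmeas]
    constructor
    · refine .of_forall fun t => ?_
      -- a function that is not integrable would have integral `0`, while `hrad` is positive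
      have h := hrad t
      by_contra hc
      rw [integral_undef hc] at h
      have := sqrt_three_sub_sqrt_two_mul_cos_pos (t - Real.pi / 4)
      have : 0 < 1 / (2 * √3 * Real.pi) *
        ((√3 - √2 * Real.cos (t - Real.pi / 4)) ^ 2)⁻¹ := by positivity
      linarith
    · have hnorm : ∀ t, ∫ r in Set.Ioi (0 : ℝ), ‖F (r, t)‖ =
          1 / (2 * √3 * Real.pi) * ((√3 - √2 * Real.cos (t - Real.pi / 4)) ^ 2)⁻¹ := by
        intro t
        rw [← hrad t]
        refine setIntegral_congr_fun measurableSet_Ioi fun r hr => ?_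
        have hr' : 0 < r := hr
        exact Real.norm_of_nonneg (by simp only [hF]; positivity)
      simp_rw [hnorm]
      refine IntegrableOn.mono_set (t := Set.Icc 0 (Real.pi / 2)) ?_ Set.Ioo_subset_Icc_self
      refine Continuous.integrableOn_Icc ?_
      have : ∀ t, (√3 - √2 * Real.cos (t - Real.pi / 4)) ^ 2 ≠ 0 := fun t =>
        (pow_pos (sqrt_three_sub_sqrt_two_mul_cos_pos _) 2).ne'
      fun_prop (disch := assumption)
  rw [hstep, Measure.volume_eq_prod, ← Measure.prod_restrict, integral_prod_symm _ hint,
    intervalIntegral.integral_of_le (by positivity), integral_Ioc_eq_integral_Ioo]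
  simp_rw [hrad]

lemma one_add_cos_pos {t : ℝ} (ht : |t| < Real.pi) : 0 < 1 + Real.cos t := by
  have h := Real.cos_lt_cos_of_nonneg_of_le_pi (abs_nonneg t) le_rfl ht
  rw [Real.cos_pi, Real.cos_abs] at h
  linarith

/-- The half-angle antiderivative of `(√3 - √2 cos t) ^ (-2)`. -/
lemma hasDerivAt_antiderivative {t : ℝ} (ht : |t| < Real.pi) :
    HasDerivAt (fun t => √2 * Real.sin t / (√3 - √2 * Real.cos t) +
      2 * √3 * Real.arctan ((√3 + √2) * (Real.sin t / (1 + Real.cos t))))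
      ((√3 - √2 * Real.cos t) ^ 2)⁻¹ t := by
  have hp := sqrt_three_sub_sqrt_two_mul_cos_pos t
  have hc := one_add_cos_pos ht
  have h1 := ((Real.hasDerivAt_sin t).const_mul √2).div
    (((Real.hasDerivAt_cos t).const_mul √2).const_sub √3) hp.ne'
  have h2 := (((Real.hasDerivAt_sin t).div ((Real.hasDerivAt_cos t).const_add 1)
    hc.ne').const_mul (√3 + √2)).arctan.const_mul (2 * √3)
  refine (h1.add h2).congr_deriv ?_
  have hsq : Real.sin t ^ 2 = 1 - Real.cos t ^ 2 := Real.sin_sq t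
  have e1 : Real.cos t * (1 + Real.cos t) - Real.sin t * -Real.sin t = 1 + Real.cos t := by
    linear_combination hsq
  have e2 : 1 + ((√3 + √2) * (Real.sin t / (1 + Real.cos t))) ^ 2 =
      2 * (√3 + √2) * (√3 - √2 * Real.cos t) / (1 + Real.cos t) := by
    rw [mul_pow, div_pow, hsq]
    have : (1 : ℝ) - Real.cos t ^ 2 = (1 + Real.cos t) * (1 - Real.cos t) := by ring
    rw [this]
    field_simp
    linear_combination (-1 - Real.cos t) * sqrt_three_sq + (Real.cos t + 1) * sqrt_two_sq
  simp only [Pi.div_apply, e1, e2]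
  field_simp
  linear_combination -√2 ^ 2 * hsq + sqrt_three_sq - sqrt_two_sq

lemma integral_inv_sq :
    ∫ t in (0 : ℝ)..(Real.pi / 2), ((√3 - √2 * Real.cos (t - Real.pi / 4)) ^ 2)⁻¹ =
      √3 + 1 + 4 * √3 * Real.arctan ((√3 + √2) * (√2 - 1)) := by
  have hpi := Real.pi_pos
  rw [intervalIntegral.integral_comp_sub_right
    (fun t => ((√3 - √2 * Real.cos t) ^ 2)⁻¹) (Real.pi / 4),
    intervalIntegral.integral_eq_sub_of_hasDerivAt (fun t ht => hasDerivAt_antiderivative ?_)]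
  · have e1 : 0 - Real.pi / 4 = -(Real.pi / 4) := by ring
    have e2 : Real.pi / 2 - Real.pi / 4 = Real.pi / 4 := by ring
    have e3 : √2 / 2 / (1 + √2 / 2) = √2 - 1 := by
      rw [div_eq_iff (by positivity)]
      linear_combination -(1 / 2 : ℝ) * sqrt_two_sq
    have e4 : √2 * (√2 / 2) = 1 := by linear_combination (1 / 2 : ℝ) * sqrt_two_sq
    have e5 : 1 / (√3 - 1) = (√3 + 1) / 2 := by
      have : √3 - 1 ≠ 0 := fun h => by
        have h3 := sqrt_three_sq
        rw [sub_eq_zero.1 h] at h3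
        norm_num at h3
      field_simp
      linear_combination -sqrt_three_sq
    rw [e1, e2, Real.sin_neg, Real.cos_neg, Real.sin_pi_div_four, Real.cos_pi_div_four, neg_div,
      mul_neg, mul_neg, Real.arctan_neg, e3, e4, neg_div, e5]
    ring
  · refine (ContinuousOn.intervalIntegrable ?_)
    refine Continuous.continuousOn ?_
    have : ∀ t, (√3 - √2 * Real.cos t) ^ 2 ≠ 0 := fun t =>
      (pow_pos (sqrt_three_sub_sqrt_two_mul_cos_pos _) 2).ne'
    fun_prop (disch := assumption)
  · rw [Set.uIcc_of_le (by linarith)] at ht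
    rw [abs_lt]
    constructor <;> linarith [ht.1, ht.2]

lemma setIntegral_quadrant_closed_form :
    ∫ z in Set.Ioi (0 : ℝ) ×ˢ Set.Ioi (0 : ℝ), pinnedDensity z =
      (√3 + 1) / (2 * √3 * Real.pi) +
        2 / Real.pi * Real.arctan ((√3 + √2) * (√2 - 1)) := by
  rw [setIntegral_quadrant_eq_polar, intervalIntegral.integral_const_mul, integral_inv_sq]
  field_simp
  ring

end Value

/-! ### Numerical bounds -/

section Numerics

lemma hasDerivAt_arctan_sub_partialSum (n : ℕ) (x : ℝ) :
    HasDerivAt (fun x : ℝ => Real.arctan x -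
      ∑ k ∈ Finset.range n, (-1) ^ k * x ^ (2 * k + 1) / (2 * k + 1))
      ((-1) ^ n * (x ^ (2 * n) / (1 + x ^ 2))) x := by
  have hsum : HasDerivAt (fun x : ℝ =>
      ∑ k ∈ Finset.range n, (-1) ^ k * x ^ (2 * k + 1) / (2 * (k : ℝ) + 1))
      (∑ k ∈ Finset.range n, (-x ^ 2) ^ k) x := by
    refine HasDerivAt.fun_sum fun k _ => ?_
    refine (((hasDerivAt_pow (2 * k + 1) x).const_mul ((-1) ^ k)).div_const _).congr_deriv ?_
    have : (2 * (k : ℝ) + 1) ≠ 0 := by positivity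
    rw [neg_pow (x ^ 2), ← pow_mul]
    push_cast
    field_simp
  refine ((Real.hasDerivAt_arctan x).sub hsum).congr_deriv ?_
  have h0 : 1 + x ^ 2 ≠ 0 := by positivity
  rw [geom_sum_eq (by nlinarith [sq_nonneg x]), neg_pow (x ^ 2) n, ← pow_mul]
  have h1 : -x ^ 2 - 1 ≠ 0 := by nlinarith [sq_nonneg x]
  field_simp
  ring

/-- The partial sums of the arctangent series are alternately below and above the arctangent
on the nonnegative half-line. -/
lemma neg_one_pow_mul_arctan_sub_partialSum_nonneg (n : ℕ) {x : ℝ} (hx : 0 ≤ x) :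
    0 ≤ (-1) ^ n * (Real.arctan x -
      ∑ k ∈ Finset.range n, (-1) ^ k * x ^ (2 * k + 1) / (2 * k + 1)) := by
  have hd := fun x => (hasDerivAt_arctan_sub_partialSum n x).const_mul ((-1 : ℝ) ^ n)
  have hmono : Monotone fun x : ℝ => (-1) ^ n * (Real.arctan x -
      ∑ k ∈ Finset.range n, (-1) ^ k * x ^ (2 * k + 1) / (2 * k + 1)) := by
    refine monotone_of_hasDerivAt_nonneg hd fun x => ?_
    rw [← mul_assoc, ← mul_pow]
    simp only [mul_neg, mul_one, neg_neg, one_pow, one_mul, Pi.zero_apply]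
    rw [pow_mul]
    positivity
  simpa using hmono hx

lemma arctan_le_partialSum {x : ℝ} (hx : 0 ≤ x) :
    Real.arctan x ≤ x - x ^ 3 / 3 + x ^ 5 / 5 - x ^ 7 / 7 + x ^ 9 / 9 := by
  have h := neg_one_pow_mul_arctan_sub_partialSum_nonneg 5 hx
  norm_num [Finset.sum_range_succ] at h
  linarith

lemma partialSum_le_arctan {x : ℝ} (hx : 0 ≤ x) :
    x - x ^ 3 / 3 + x ^ 5 / 5 - x ^ 7 / 7 + x ^ 9 / 9 - x ^ 11 / 11 ≤ Real.arctan x := by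
  have h := neg_one_pow_mul_arctan_sub_partialSum_nonneg 6 hx
  norm_num [Finset.sum_range_succ] at h
  linarith

lemma arctan_eq_pi_div_four_add {u : ℝ} (hu : 0 < u) :
    Real.arctan u = Real.pi / 4 + Real.arctan ((u - 1) / (u + 1)) := by
  rw [← Real.arctan_one, Real.arctan_add]
  · congr 1
    field_simp
    ring
  · rw [one_mul, div_lt_one (by linarith)]
    linarith

lemma sqrt_two_gt : 1.41421356237309 < √2 := Real.lt_sqrt_of_sq_lt (by norm_num)

lemma sqrt_two_lt : √2 < 1.41421356237310 := (Real.sqrt_lt' (by norm_num)).2 (by norm_num)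

lemma sqrt_three_gt : 1.73205080756887 < √3 := Real.lt_sqrt_of_sq_lt (by norm_num)

lemma sqrt_three_lt : √3 < 1.73205080756888 := (Real.sqrt_lt' (by norm_num)).2 (by norm_num)

lemma arctan_argument_gt : 1.3032253728411 < (√3 + √2) * (√2 - 1) :=
  calc (1.3032253728411 : ℝ)
      < (1.73205080756887 + 1.41421356237309) * (1.41421356237309 - 1) := by norm_num
    _ < _ := mul_lt_mul'' (add_lt_add sqrt_three_gt sqrt_two_gt) (sub_lt_sub_right sqrt_two_gt 1)
      (by norm_num) (by norm_num)

lemma arctan_argument_lt : (√3 + √2) * (√2 - 1) < 1.3032253728413 :=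
  calc (√3 + √2) * (√2 - 1)
      < (1.73205080756888 + 1.41421356237310) * (1.41421356237310 - 1) :=
        mul_lt_mul'' (add_lt_add sqrt_three_lt sqrt_two_lt) (sub_lt_sub_right sqrt_two_lt 1)
          (by positivity) (by linarith [sqrt_two_gt])
    _ < _ := by norm_num

lemma arctan_argument_pos : 0 < (√3 + √2) * (√2 - 1) :=
  lt_trans (by norm_num) arctan_argument_gt

/-- Shifting the angle by `π / 4` replaces the argument by one small enough for five or six terms
of the arctangent series to decide the tenth decimal. -/
lemma setIntegral_quadrant_eq_half_add :
    ∫ z in Set.Ioi (0 : ℝ) ×ˢ Set.Ioi (0 : ℝ), pinnedDensity z =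
      1 / 2 + ((3 + √3) / 6 + 2 * Real.arctan (((√3 + √2) * (√2 - 1) - 1) /
        ((√3 + √2) * (√2 - 1) + 1))) / Real.pi := by
  rw [setIntegral_quadrant_closed_form, arctan_eq_pi_div_four_add arctan_argument_pos]
  field_simp
  linear_combination (-8 : ℝ) * sqrt_three_sq

lemma reduced_argument_gt :
    0.1316524975873 < ((√3 + √2) * (√2 - 1) - 1) / ((√3 + √2) * (√2 - 1) + 1) := by
  rw [lt_div_iff₀ (by linarith [arctan_argument_pos])]
  linarith [arctan_argument_gt]

lemma reduced_argument_lt :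
    ((√3 + √2) * (√2 - 1) - 1) / ((√3 + √2) * (√2 - 1) + 1) < 0.1316524975875 := by
  rw [div_lt_iff₀ (by linarith [arctan_argument_pos])]
  linarith [arctan_argument_lt]

lemma setIntegral_quadrant_gt :
    0.8343764256 < ∫ z in Set.Ioi (0 : ℝ) ×ˢ Set.Ioi (0 : ℝ), pinnedDensity z := by
  rw [setIntegral_quadrant_eq_half_add, ← sub_lt_iff_lt_add', lt_div_iff₀ Real.pi_pos]
  have h1 := Real.arctan_strictMono reduced_argument_gt
  have h2 := partialSum_le_arctan (x := 0.1316524975873) (by norm_num)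
  linarith [sqrt_three_gt, Real.pi_lt_d20]

lemma setIntegral_quadrant_lt :
    ∫ z in Set.Ioi (0 : ℝ) ×ˢ Set.Ioi (0 : ℝ), pinnedDensity z < 0.8343764257 := by
  rw [setIntegral_quadrant_eq_half_add, ← lt_sub_iff_add_lt', div_lt_iff₀ Real.pi_pos]
  have h1 := Real.arctan_strictMono reduced_argument_lt
  have h2 := arctan_le_partialSum (x := 0.1316524975875) (by norm_num)
  linarith [sqrt_three_lt, Real.pi_gt_d20]

end Numerics

/-! ### The pinned tetrahedron -/

theorem mainTheorem3 {Ω : Type*} [MeasurableSpace Ω] (P : Measure Ω) [IsProbabilityMeasure P]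
    (A B C : Ω → EuclideanSpace ℝ (Fin 3))
    (hA : HasLaw A (stdGaussian (EuclideanSpace ℝ (Fin 3))) P)
    (hB : HasLaw B (stdGaussian (EuclideanSpace ℝ (Fin 3))) P)
    (hC : HasLaw C (stdGaussian (EuclideanSpace ℝ (Fin 3))) P)
    (hABC : iIndepFun ![A, B, C] P) :
    -- the probability as a double integral, and its numerical value
    (IntegrableOn pinnedDensity (Set.Ioi 0 ×ˢ Set.Ioi 0) ∧
      P.real {ω | 0 < inner ℝ (B ω - A ω) (-A ω) ∧ 0 < inner ℝ (C ω - A ω) (-A ω)} =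
        ∫ z₁ in Set.Ioi (0 : ℝ), ∫ z₂ in Set.Ioi (0 : ℝ), pinnedDensity (z₁, z₂) ∧
      0.8343764256 <
        ∫ z₁ in Set.Ioi (0 : ℝ), ∫ z₂ in Set.Ioi (0 : ℝ), pinnedDensity (z₁, z₂) ∧
      ∫ z₁ in Set.Ioi (0 : ℝ), ∫ z₂ in Set.Ioi (0 : ℝ), pinnedDensity (z₁, z₂) <
        0.8343764257) ∧
    -- in each coordinate, the pair of products has density `productDensity`
    (∀ k : Fin 3,
      HasLaw (fun ω => ((B ω k - A ω k) * (-A ω k), (C ω k - A ω k) * (-A ω k)))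
        ((volume : Measure (ℝ × ℝ)).withDensity fun z => ENNReal.ofReal (productDensity z)) P) ∧
    -- the Fourier transform of `productDensity` is `F`, that of `pinnedDensity` is `F³`
    (∀ w₁ w₂ : ℝ,
      Integrable (fun z : ℝ × ℝ => fourierKernel w₁ w₂ z * (productDensity z : ℂ)) ∧
      ∫ z : ℝ × ℝ, fourierKernel w₁ w₂ z * (productDensity z : ℂ) = productCharFun w₁ w₂ ∧
      Integrable (fun z : ℝ × ℝ => fourierKernel w₁ w₂ z * (pinnedDensity z : ℂ)) ∧
      ∫ z : ℝ × ℝ, fourierKernel w₁ w₂ z * (pinnedDensity z : ℂ) =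
        productCharFun w₁ w₂ ^ 3) := by
  refine ⟨⟨integrable_pinnedDensity.integrableOn, ?_, ?_, ?_⟩,
    hasLaw_coordinate_products hA hB hC hABC, fun w₁ w₂ =>
    ⟨integrable_fourierKernel_mul integrable_productDensity w₁ w₂,
      integral_fourierKernel_mul_productDensity w₁ w₂,
      integrable_fourierKernel_mul integrable_pinnedDensity w₁ w₂,
      integral_fourierKernel_mul_pinnedDensity w₁ w₂⟩⟩
  · rw [← setIntegral_quadrant_pinnedDensity, prob_inner_products_pos hA hB hC hABC]
  · rw [← setIntegral_quadrant_pinnedDensity]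
    exact setIntegral_quadrant_gt
  · rw [← setIntegral_quadrant_pinnedDensity]
    exact setIntegral_quadrant_lt
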